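/- Fix $q\in\mathbb N$ and $\beta\in\mathbb R^q$. For each $l$ consider the linear regression $y_l=X_l\beta+\delta_l$, where $X_l\in\mathbb R^{l\times q}$ is a deterministic matrix with $\operatorname{rank}X_l=q$ whenever $l\ge q$, and $\delta_l=\sqrt{Q_l}\,\gamma_l$ with $Q_l\in\mathbb R^{l\times l}$ symmetric positive definite, $\sqrt{Q_l}$ its positive definite square root, and $\gamma_l=(\gamma_{l1},\dots,\gamma_{ll})^\top$ a random vector. Suppose that for each $l$ the coordinates $\gamma_{l1},\dots,\gamma_{ll}$ are independent, and that all $\gamma_{lj}$ ($1\le j\le l$, $l\in\mathbb N$) have one and the same distribution, not depending on $l$ or $j$, with mean $0$ and variance $1$. (The vectors $\gamma_l$ for different $l$ may be defined on different probability spaces or be arbitrarily dependent.) Let $\hat\beta^{(l)}=(X_l^\top X_l)^{-1}X_l^\top y_l$ be the least-squares estimator and let $A_l=(X_l^\top X_l)^{-1}X_l^\top\sqrt{Q_l}\in\mathbb R^{q\times l}$, for $l\ge q$. Then for every $t\in\mathbb R^q\setminus\{0\}$ such that $$\frac{\|A_l^\top t\|_2}{\|A_l^\top t\|_\infty}\longrightarrow\infty\qquad(l\to\infty),$$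 where $\|\cdot\|_2$ and $\|\cdot\|_\infty$ are the Euclidean and the maximum norm on $\mathbb R^l$, one has $$\frac{t^\top(\hat\beta^{(l)}-\beta)}{\sqrt{t^\top (X_l^\top X_l)^{-1}X_l^\top Q_lX_l(X_l^\top X_l)^{-1}t}}\ \stackrel{d}{\longrightarrow}\ Z\sim N(0,1)\qquad(l\to\infty).$$ -/

import Mathlib

open MeasureTheory ProbabilityTheory Filter Topology
open scoped Matrix MatrixOrder

noncomputable section

/-- The least-squares estimator `(Xᵀ X)⁻¹ Xᵀ y` of the regression parameter vector. -/
def leastSquaresEstimator {l q : ℕ} (X : Matrix (Fin l) (Fin q) ℝ) (y : Fin l → ℝ) :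
    Fin q → ℝ :=
  ((Xᵀ * X)⁻¹ * Xᵀ) *ᵥ y

/-- The matrix `A = (Xᵀ X)⁻¹ Xᵀ √Q`, with `√Q` the positive semidefinite square root of `Q`. -/
def errorTransferMatrix {l q : ℕ} (X : Matrix (Fin l) (Fin q) ℝ)
    (Q : Matrix (Fin l) (Fin l) ℝ) : Matrix (Fin q) (Fin l) ℝ :=
  (Xᵀ * X)⁻¹ * Xᵀ * CFC.sqrt Q

/-- The matrix `(Xᵀ X)⁻¹ Xᵀ Q X (Xᵀ X)⁻¹`. -/
def estimatorCovariance {l q : ℕ} (X : Matrix (Fin l) (Fin q) ℝ)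
    (Q : Matrix (Fin l) (Fin l) ℝ) : Matrix (Fin q) (Fin q) ℝ :=
  (Xᵀ * X)⁻¹ * Xᵀ * Q * X * (Xᵀ * X)⁻¹

/-- The Euclidean norm of a real vector. -/
def euclNorm {l : ℕ} (v : Fin l → ℝ) : ℝ := Real.sqrt (∑ j, v j ^ 2)

/-- The maximum norm `max_j |v j|` of a real vector (`0` for the empty vector). -/
def maxNorm {l : ℕ} (v : Fin l → ℝ) : ℝ := ⨆ j, |v j|

end

/-! With a = Aᵀt, the projected error is a ⬝ᵥ γ and the normalizer is ‖a‖₂, so the statistic is ∑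
c_j γ_j with c = a/‖a‖₂. Here ∑ c_j² = 1, and the norm-ratio hypothesis says exactly that max |c_j|
→ 0. All γ_j share one law ν, so a single Taylor estimate serves every factor: `charFun ν` differs
from the Gaussian one by o(s²) at s = c_j u. Comparing products in the unit disc
(`norm_prod_sub_prod_le_sum`) then costs o(1) · u² ∑ c_j², which vanishes (`tendsto_prod_charFun`).
Lévy's continuity theorem concludes; it sees only the laws, so the probability spaces may vary with
l. -/

open Asymptotics in
/-- The characteristic function of a centred law with unit variance agrees with that of the
standard Gaussian law up to `o(s ^ 2)`. -/
lemma charFun_sub_charFun_gaussianReal_isLittleO (ν : Measure ℝ) [IsProbabilityMeasure ν]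
    (hν_mean : ∫ x, x ∂ν = 0) (hν_var : ∫ x, x ^ 2 ∂ν = 1) :
    (fun s : ℝ => charFun ν s - charFun (gaussianReal 0 1) s) =o[𝓝 0] fun s => s ^ 2 := by
  have key : ∀ μ : Measure ℝ, IsProbabilityMeasure μ → ∫ x, x ∂μ = 0 → ∫ x, x ^ 2 ∂μ = 1 →
      (fun s : ℝ => charFun μ s - (1 - s ^ 2 / 2)) =o[𝓝 0] fun s => s ^ 2 := by
    intro μ _ h0 h1
    simpa using taylor_charFun_two (P := μ) (X := id) aemeasurable_id (by simpa using h0)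
      (by simpa using h1)
  have hg : ∫ x, x ^ 2 ∂(gaussianReal 0 1) = 1 := by
    have h := variance_eq_integral (μ := gaussianReal 0 1) (X := id) aemeasurable_id
    rw [variance_id_gaussianReal] at h
    simpa using h.symm
  refine ((key ν inferInstance hν_mean hν_var).sub
    (key _ inferInstance integral_id_gaussianReal hg)).congr_left fun s => ?_
  ring

/-- A difference of products of elements of the unit disc is bounded by the sum of the
differences. -/
lemma norm_prod_sub_prod_le_sum {ι : Type*} (s : Finset ι) (f g : ι → ℂ)
    (hf : ∀ i ∈ s, ‖f i‖ ≤ 1) (hg : ∀ i ∈ s, ‖g i‖ ≤ 1) :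
    ‖∏ i ∈ s, f i - ∏ i ∈ s, g i‖ ≤ ∑ i ∈ s, ‖f i - g i‖ := by
  classical
  induction s using Finset.induction_on with
  | empty => simp
  | insert a s ha ih =>
    rw [Finset.prod_insert ha, Finset.prod_insert ha, Finset.sum_insert ha]
    have ih' := ih (fun i hi => hf i (Finset.mem_insert_of_mem hi))
      (fun i hi => hg i (Finset.mem_insert_of_mem hi))
    have hfs : ‖∏ i ∈ s, f i‖ ≤ 1 := by
      rw [norm_prod]
      exact Finset.prod_le_one (fun _ _ => norm_nonneg _)
        fun i hi => hf i (Finset.mem_insert_of_mem hi)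
    have hga := hg a (Finset.mem_insert_self a s)
    -- Telescoping: exchange one factor at a time.
    calc ‖f a * ∏ i ∈ s, f i - g a * ∏ i ∈ s, g i‖
        = ‖(f a - g a) * ∏ i ∈ s, f i + g a * (∏ i ∈ s, f i - ∏ i ∈ s, g i)‖ := by ring_nf
      _ ≤ ‖f a - g a‖ * ‖∏ i ∈ s, f i‖ + ‖g a‖ * ‖∏ i ∈ s, f i - ∏ i ∈ s, g i‖ := by
        rw [← norm_mul, ← norm_mul]; exact norm_add_le _ _
      _ ≤ ‖f a - g a‖ * 1 + 1 * ‖∏ i ∈ s, f i - ∏ i ∈ s, g i‖ := by gcongr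
      _ ≤ _ := by linarith

lemma charFun_map_weighted_sum {Ω : Type*} [MeasurableSpace Ω] {P : Measure Ω} {ν : Measure ℝ}
    {l : ℕ} {γ : Ω → Fin l → ℝ} (hlaw : ∀ j, HasLaw (fun ω => γ ω j) ν P)
    (hindep : iIndepFun (fun (j : Fin l) (ω : Ω) => γ ω j) P) (c : Fin l → ℝ) (u : ℝ) :
    charFun (P.map fun ω => ∑ j, c j * γ ω j) u = ∏ j, charFun ν (c j * u) := by
  have hm : ∀ j, AEMeasurable (fun ω => γ ω j) P := fun j => (hlaw j).aemeasurable
  have hind : iIndepFun (fun (j : Fin l) (ω : Ω) => c j * γ ω j) P :=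
    hindep.comp (fun j x => c j * x) fun j => by fun_prop
  rw [hind.charFun_map_fun_sum_eq_prod fun j => (hm j).const_mul _, Finset.prod_apply]
  refine Finset.prod_congr rfl fun j _ => ?_
  rw [charFun_map_mul_comp (hm j), (hlaw j).map_eq]

/-- Products of the characteristic function along a triangular array of asymptotically
negligible weights of unit Euclidean length converge to the Gaussian characteristic function. -/
lemma tendsto_prod_charFun (ν : Measure ℝ) [IsProbabilityMeasure ν]
    (hν_mean : ∫ x, x ∂ν = 0) (hν_var : ∫ x, x ^ 2 ∂ν = 1)
    (c : (l : ℕ) → Fin l → ℝ) (hc : ∀ᶠ l in atTop, ∑ j, c l j ^ 2 = 1)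
    (hmax : ∀ ε > 0, ∀ᶠ l in atTop, ∀ j, |c l j| < ε) (u : ℝ) :
    Tendsto (fun l => ∏ j, charFun ν (c l j * u)) atTop
      (𝓝 (charFun (gaussianReal 0 1) u)) := by
  -- The Gaussian product is exact, since the exponents -(c_j u)²/2 add up to -u²/2.
  have hg : ∀ᶠ l in atTop,
      ∏ j, charFun (gaussianReal 0 1) (c l j * u) = charFun (gaussianReal 0 1) u := by
    filter_upwards [hc] with l hl
    simp only [charFun_gaussianReal]
    rw [← Complex.exp_sum]
    congr 1
    have hl' : ∑ j, (c l j : ℂ) ^ 2 = 1 := by exact_mod_cast hl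
    simp only [Complex.ofReal_zero, mul_zero, zero_mul, zero_sub, NNReal.coe_one,
      Complex.ofReal_one, one_mul, Complex.ofReal_mul, mul_pow]
    rw [Finset.sum_neg_distrib, ← Finset.sum_div, ← Finset.sum_mul, hl', one_mul]
  rw [Metric.tendsto_atTop']
  intro ε hε
  -- Chosen so that the summed error, this constant times u², stays below ε; the +1 here and in `r /
  -- (|u| + 1)` covers u = 0.
  have hη : 0 < ε / (2 * (u ^ 2 + 1)) := by positivity
  obtain ⟨r, hr, hbound⟩ := Metric.eventually_nhds_iff.1
    ((charFun_sub_charFun_gaussianReal_isLittleO ν hν_mean hν_var).def hη)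
  obtain ⟨N, hN⟩ := eventually_atTop.1
    (hc.and (hg.and (hmax (r / (|u| + 1)) (by positivity))))
  refine ⟨N, fun l hl => ?_⟩
  obtain ⟨h1, h2, h3⟩ := hN l hl.le
  rw [dist_eq_norm, ← h2]
  calc _ ≤ ∑ j, ‖charFun ν (c l j * u) - charFun (gaussianReal 0 1) (c l j * u)‖ :=
        norm_prod_sub_prod_le_sum _ _ _ (fun _ _ => norm_charFun_le_one _)
          (fun _ _ => norm_charFun_le_one _)
    _ ≤ ∑ j, ε / (2 * (u ^ 2 + 1)) * (c l j ^ 2 * u ^ 2) := by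
        refine Finset.sum_le_sum fun j _ => ?_
        have hj : dist (c l j * u) 0 < r := by
          rw [dist_zero_right, Real.norm_eq_abs, abs_mul]
          calc |c l j| * |u| ≤ |c l j| * (|u| + 1) := by gcongr; linarith
            _ < r / (|u| + 1) * (|u| + 1) := by gcongr; exact h3 j
            _ = r := by field_simp
        simpa [mul_pow] using hbound hj
    _ = ε / (2 * (u ^ 2 + 1)) * u ^ 2 := by
        rw [← Finset.mul_sum, ← Finset.sum_mul, h1, one_mul]
    _ < ε := by
        rw [div_mul_eq_mul_div, div_lt_iff₀ (by positivity)]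
        nlinarith [sq_nonneg u]

/-- Central limit theorem for weighted sums of independent identically distributed variables. -/
theorem tendstoInDistribution_weighted_sum
    {Ω : ℕ → Type*} [∀ l, MeasurableSpace (Ω l)]
    (P : (l : ℕ) → Measure (Ω l)) [∀ l, IsProbabilityMeasure (P l)]
    (ν : Measure ℝ) [IsProbabilityMeasure ν]
    (hν_mean : ∫ x, x ∂ν = 0) (hν_var : ∫ x, x ^ 2 ∂ν = 1)
    (γ : (l : ℕ) → Ω l → (Fin l → ℝ))
    (hγ_law : ∀ (l : ℕ) (j : Fin l), HasLaw (fun ω => γ l ω j) ν (P l))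
    (hγ_indep : ∀ l : ℕ, iIndepFun (fun (j : Fin l) (ω : Ω l) => γ l ω j) (P l))
    {Ω' : Type*} [MeasurableSpace Ω'] (P' : Measure Ω') [IsProbabilityMeasure P']
    (Z : Ω' → ℝ) (hZ : HasLaw Z (gaussianReal 0 1) P')
    (c : (l : ℕ) → Fin l → ℝ) (hc : ∀ᶠ l in atTop, ∑ j, c l j ^ 2 = 1)
    (hmax : ∀ ε > 0, ∀ᶠ l in atTop, ∀ j, |c l j| < ε)
    (S : (l : ℕ) → Ω l → ℝ) (hS_meas : ∀ l, AEMeasurable (S l) (P l))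
    (hS : ∀ᶠ l in atTop, ∀ ω, S l ω = ∑ j, c l j * γ l ω j) :
    TendstoInDistribution S atTop Z P P' where
  forall_aemeasurable := hS_meas
  aemeasurable_limit := hZ.aemeasurable
  tendsto := by
    refine ProbabilityMeasure.tendsto_iff_tendsto_charFun.2 fun u => ?_
    simp only [ProbabilityMeasure.coe_mk]
    rw [hZ.map_eq]
    refine (tendsto_prod_charFun ν hν_mean hν_var c hc hmax u).congr' ?_
    filter_upwards [hS] with l hl
    rw [← charFun_map_weighted_sum (hγ_law l) (hγ_indep l), funext hl]

lemma isUnit_transpose_mul_self_of_rank_eq {l q : ℕ} (X : Matrix (Fin l) (Fin q) ℝ)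
    (hX : X.rank = q) : IsUnit (Xᵀ * X) := by
  rw [← Matrix.linearIndependent_rows_iff_isUnit, linearIndependent_iff_card_eq_finrank_span,
    Set.finrank, ← Matrix.rank_eq_finrank_span_row, Matrix.rank_transpose_mul_self, hX,
    Fintype.card_fin]

/-- The estimation error, projected on `t`, is a linear form in the noise. -/
lemma dotProduct_leastSquaresEstimator_sub {l q : ℕ} (X : Matrix (Fin l) (Fin q) ℝ)
    (hX : X.rank = q) (Q : Matrix (Fin l) (Fin l) ℝ) (β t : Fin q → ℝ) (g : Fin l → ℝ) :
    t ⬝ᵥ (leastSquaresEstimator X (X *ᵥ β + CFC.sqrt Q *ᵥ g) - β) =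
      ((errorTransferMatrix X Q)ᵀ *ᵥ t) ⬝ᵥ g := by
  have hdet : IsUnit (Xᵀ * X).det :=
    (Matrix.isUnit_iff_isUnit_det _).1 (isUnit_transpose_mul_self_of_rank_eq X hX)
  have h : leastSquaresEstimator X (X *ᵥ β + CFC.sqrt Q *ᵥ g) - β =
      errorTransferMatrix X Q *ᵥ g := by
    rw [leastSquaresEstimator, errorTransferMatrix, Matrix.mulVec_add, Matrix.mulVec_mulVec,
      Matrix.mulVec_mulVec, Matrix.mul_assoc _ Xᵀ X, Matrix.nonsing_inv_mul _ hdet,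
      Matrix.one_mulVec, add_sub_cancel_left]
  rw [h, Matrix.mulVec_transpose, Matrix.dotProduct_mulVec]

/-- The asymptotic standard deviation is the Euclidean norm of the transferred direction. -/
lemma sqrt_dotProduct_estimatorCovariance {l q : ℕ} (X : Matrix (Fin l) (Fin q) ℝ)
    (Q : Matrix (Fin l) (Fin l) ℝ) (hQ : Q.PosDef) (t : Fin q → ℝ) :
    Real.sqrt (t ⬝ᵥ (estimatorCovariance X Q *ᵥ t)) =
      euclNorm ((errorTransferMatrix X Q)ᵀ *ᵥ t) := by
  have hs : CFC.sqrt Q * CFC.sqrt Q = Q := CFC.sqrt_mul_sqrt_self Q hQ.posSemidef.nonneg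
  have hsT : (CFC.sqrt Q)ᵀ = CFC.sqrt Q := by
    have := (Matrix.nonneg_iff_posSemidef.1 (CFC.sqrt_nonneg Q)).isHermitian.eq
    simpa using this
  -- As √Q is symmetric with square Q, the covariance is AAᵀ, whose quadratic form at t is ‖Aᵀt‖₂².
  have hfac : estimatorCovariance X Q =
      errorTransferMatrix X Q * (errorTransferMatrix X Q)ᵀ := by
    rw [estimatorCovariance, errorTransferMatrix]
    simp only [Matrix.transpose_mul, Matrix.transpose_transpose, Matrix.transpose_nonsing_inv,
      hsT, Matrix.mul_assoc]
    rw [← Matrix.mul_assoc (CFC.sqrt Q) (CFC.sqrt Q), hs]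
  rw [hfac, euclNorm, ← Matrix.mulVec_mulVec, Matrix.dotProduct_mulVec,
    ← Matrix.mulVec_transpose]
  simp only [dotProduct, sq]

lemma abs_le_maxNorm {l : ℕ} (v : Fin l → ℝ) (j : Fin l) : |v j| ≤ maxNorm v :=
  le_ciSup (f := fun j => |v j|) (Set.finite_range _).bddAbove j

theorem mainTheorem6 {q : ℕ} (X : (l : ℕ) → Matrix (Fin l) (Fin q) ℝ)
    (hX : ∀ l : ℕ, q ≤ l → (X l).rank = q)
    (Q : (l : ℕ) → Matrix (Fin l) (Fin l) ℝ) (hQ : ∀ l : ℕ, (Q l).PosDef)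
    {Ω : ℕ → Type*} [∀ l, MeasurableSpace (Ω l)]
    (P : (l : ℕ) → Measure (Ω l)) [∀ l, IsProbabilityMeasure (P l)]
    (ν : Measure ℝ) [IsProbabilityMeasure ν]
    (hν_sq : Integrable (fun x : ℝ => x ^ 2) ν)
    (hν_mean : ∫ x, x ∂ν = 0) (hν_var : ∫ x, x ^ 2 ∂ν = 1)
    (γ : (l : ℕ) → Ω l → (Fin l → ℝ))
    (hγ_law : ∀ (l : ℕ) (j : Fin l), HasLaw (fun ω => γ l ω j) ν (P l))
    (hγ_indep : ∀ l : ℕ, iIndepFun (fun (j : Fin l) (ω : Ω l) => γ l ω j) (P l))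
    (δ : (l : ℕ) → Ω l → (Fin l → ℝ))
    (hδ : ∀ (l : ℕ) (ω : Ω l), δ l ω = CFC.sqrt (Q l) *ᵥ γ l ω)
    (β : Fin q → ℝ) (y : (l : ℕ) → Ω l → (Fin l → ℝ))
    (hy : ∀ (l : ℕ) (ω : Ω l), y l ω = X l *ᵥ β + δ l ω)
    {Ω' : Type*} [MeasurableSpace Ω'] (P' : Measure Ω') [IsProbabilityMeasure P']
    (Z : Ω' → ℝ) (hZ : HasLaw Z (gaussianReal 0 1) P')
    (t : Fin q → ℝ) (ht : t ≠ 0)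
    (hA : Tendsto
      (fun l : ℕ => euclNorm ((errorTransferMatrix (X l) (Q l))ᵀ *ᵥ t) /
        maxNorm ((errorTransferMatrix (X l) (Q l))ᵀ *ᵥ t)) atTop atTop) :
    TendstoInDistribution
      (fun (l : ℕ) (ω : Ω l) =>
        t ⬝ᵥ (leastSquaresEstimator (X l) (y l ω) - β) /
          Real.sqrt (t ⬝ᵥ (estimatorCovariance (X l) (Q l) *ᵥ t)))
      atTop Z P P' := by
  set a : (l : ℕ) → Fin l → ℝ := fun l => (errorTransferMatrix (X l) (Q l))ᵀ *ᵥ t with ha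
  have hpos : ∀ᶠ l in atTop, 0 < euclNorm (a l) := by
    filter_upwards [hA.eventually_gt_atTop 0] with l hl
    -- A zero numerator would make the ratio 0, contradicting its divergence.
    refine (Real.sqrt_nonneg _).lt_of_ne fun h => ?_
    change 0 < euclNorm (a l) / maxNorm (a l) at hl
    rw [euclNorm, ← h, zero_div] at hl
    exact hl.false
  refine tendstoInDistribution_weighted_sum P ν hν_mean hν_var γ hγ_law hγ_indep P' Z hZ
    (fun l j => a l j / euclNorm (a l)) ?_ ?_ _ ?_ ?_
  · filter_upwards [hpos] with l hl
    simp only [div_pow]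
    have hsq : euclNorm (a l) ^ 2 = ∑ j, a l j ^ 2 :=
      Real.sq_sqrt (Finset.sum_nonneg fun _ _ => sq_nonneg _)
    rw [← Finset.sum_div, ← hsq, div_self (pow_ne_zero _ hl.ne')]
  · intro ε hε
    filter_upwards [hpos, hA.eventually_gt_atTop ε⁻¹] with l hl hl' j
    change ε⁻¹ < euclNorm (a l) / maxNorm (a l) at hl'
    have hm : 0 < maxNorm (a l) := by
      by_contra hm
      exact ((inv_pos.2 hε).trans hl').not_ge (div_nonpos_of_nonneg_of_nonpos hl.le (not_lt.1 hm))
    rw [abs_div, abs_of_pos hl, div_lt_iff₀ hl]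
    rw [lt_div_iff₀ hm, inv_mul_lt_iff₀ hε] at hl'
    exact (abs_le_maxNorm _ j).trans_lt hl'
  · intro l
    have hm : ∀ j, AEMeasurable (fun ω => γ l ω j) (P l) := fun j => (hγ_law l j).aemeasurable
    have hγm : AEMeasurable (γ l) (P l) := aemeasurable_pi_iff.2 hm
    -- Measurability is needed for every l, even l < q where XᵀX is singular; the expression is
    -- still affine in g for whatever fixed matrix `⁻¹` returns.
    have hcont : Continuous fun g : Fin l → ℝ =>
        t ⬝ᵥ (leastSquaresEstimator (X l) (X l *ᵥ β + CFC.sqrt (Q l) *ᵥ g) - β) /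
          Real.sqrt (t ⬝ᵥ (estimatorCovariance (X l) (Q l) *ᵥ t)) := by
      unfold leastSquaresEstimator
      fun_prop
    simp only [hy, hδ]
    exact hcont.measurable.comp_aemeasurable hγm
  · filter_upwards [eventually_ge_atTop q] with l hl ω
    rw [hy, hδ, dotProduct_leastSquaresEstimator_sub _ (hX l hl),
      sqrt_dotProduct_estimatorCovariance _ _ (hQ l), dotProduct, Finset.sum_div]
    exact Finset.sum_congr rfl fun j _ => by rw [div_mul_eq_mul_div]
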